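/- **Theorem 2.** Let $n,k,d\in\mathbb N$, let $\mathcal W$ be a set (the values of the proxy $\mathbf W$), and let $p_\varepsilon$ be a fixed probability density on $\mathbb R^d$. A parameter $\theta=(f,H,\lambda)$, together with base measures $Q_1,\dots,Q_n\ge 0$ (densities on $\mathbb R$), describes the model $\mathbf X^{\mathrm{re}}=f(\mathbf C)+\varepsilon$, where $f:\mathbb R^n\to\mathbb R^d$, the noise $\varepsilon$ has density $p_\varepsilon$ and is independent of $\mathbf C$, and $\mathbf C\in\mathbb R^n$ given $\mathbf W=w$ has density $$p_{H,\lambda}(c\mid w)=\prod_{i=1}^n\frac{Q_i(c_i)}{Z_i(w)}\exp\Big[\sum_{j=1}^k H_{i,j}(c_i)\lambda_{i,j}(w)\Big],\qquad Z_i(w)=\int_{\mathbb R} Q_i(t)\exp\Big[\sum_{j=1}^k H_{i,j}(t)\lambda_{i,j}(w)\Big]dt\in(0,\infty),$$ with $f,H_{i,j},Q_i$ measurable and $\lambda_{i,j}:\mathcal W\to\mathbb R$ arbitrary. So $\mathbf X^{\mathrm{re}}$ given $\mathbf W=w$ has density $p_\theta(x\mid w)=\int p_{H,\lambda}(c\mid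 w)\,p_\varepsilon(x-f(c))\,dc$. Write $\mathbf H(c)=(H_{i,j}(c_i))_{i,j}\in\mathbb R^{nk}$. Let $\theta=(f,H,\lambda)$ be such that 1. the set of zeros of the characteristic function $\varphi_\varepsilon$ of $p_\varepsilon$ has Lebesgue measure zero; 2. $f$ is injective; 3. every $H_{i,j}$ is differentiable almost everywhere, and for every $i$ no nontrivial linear combination of $H_{i,1},\dots,H_{i,k}$ is constant on a set of positive Lebesgue measure; 4. there are $nk+1$ distinct points $w_0,\dots,w_{nk}\in\mathcal W$ such that the $nk\times nk$ matrix $L=(\lambda(w_1)-\lambda(w_0),\dots,\lambda(w_{nk})-\lambda(w_0))$ is invertible. Then $\theta$ is identifiable up to an invertible affine transformation of the sufficient statistics: let $\tilde\theta=(\tilde f,\tilde H,\tilde\lambda)$, with base measures $\tilde Q_i$, be any other parameter with $\tilde f$ injective and, for every $w\in\mathcal W$, $p_\theta(x\mid w)=p_{\tilde\theta}(x\mid w)$ for almost every $x$. Then there are an invertible $nk\times nk$ matrix $M$ and a vector $q\in\mathbb R^{nk}$ such that $$\mathbf H(f^{-1}(x))=M\,\tilde{\mathbf H}(\tilde f^{-1}(x))+q$$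 for almost every $x$ with respect to the law of the noise-free signal $f(\mathbf C)$ given $\mathbf W=w$, for every $w$ (in particular, almost every such $x$ lies in the images of both $f$ and $\tilde f$). If moreover, for both parameters, the mixing function is a homeomorphism onto its image, the sufficient statistics are continuous, and the base measures are positive almost everywhere, then with the same $M$ and $q$ the identity holds for every $x$ in $f(\mathbb R^n)\cap\tilde f(\mathbb R^n)$. -/

import Mathlib

open MeasureTheory Set

noncomputable section

/-- Parameters `(f, H, lam)` (together with the base measures `Q i`) of the generative model
`X = f C + ε`, where `C` takes values in `ℝⁿ`, `X` in `ℝᵈ`, and the density of `C` given the proxy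
value `w` is the factorial exponential family with base measures `Q i`, sufficient statistics
`H i j` and natural parameters `lam w i j`. -/
structure LatentModel (n k d : ℕ) (𝒲 : Type*) where
  /-- the mixing (decoder) function -/
  f : (Fin n → ℝ) → EuclideanSpace ℝ (Fin d)
  /-- the sufficient statistics -/
  H : Fin n → Fin k → ℝ → ℝ
  /-- the natural parameters, an arbitrary function of the proxy value -/
  lam : 𝒲 → Fin n → Fin k → ℝ
  /-- the densities of the base measures -/
  Q : Fin n → ℝ → ℝ
  measurable_f : Measurable f
  measurable_H : ∀ i j, Measurable (H i j)
  measurable_Q : ∀ i, Measurable (Q i)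
  Q_nonneg : ∀ i t, 0 ≤ Q i t
  /-- the normalization constants are finite ... -/
  integrable_weight : ∀ w i,
    Integrable (fun t : ℝ => Q i t * Real.exp (∑ j, H i j t * lam w i j)) volume
  /-- ... and positive -/
  normalizer_pos : ∀ w i, 0 < ∫ t : ℝ, Q i t * Real.exp (∑ j, H i j t * lam w i j)

namespace LatentModel

variable {n k d : ℕ} {𝒲 : Type*}

/-- The normalization constant `Z_i(w)`. -/
def Z (θ : LatentModel n k d 𝒲) (i : Fin n) (w : 𝒲) : ℝ :=
  ∫ t : ℝ, θ.Q i t * Real.exp (∑ j, θ.H i j t * θ.lam w i j)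

/-- The density `p_{H,lam}(c | w)` of the latent variable given the proxy value. -/
def latentDensity (θ : LatentModel n k d 𝒲) (w : 𝒲) (c : Fin n → ℝ) : ℝ :=
  ∏ i, θ.Q i (c i) / θ.Z i w * Real.exp (∑ j, θ.H i j (c i) * θ.lam w i j)

/-- The law of `C` given the proxy value `w`. -/
def latentLaw (θ : LatentModel n k d 𝒲) (w : 𝒲) : Measure (Fin n → ℝ) :=
  volume.withDensity fun c => ENNReal.ofReal (θ.latentDensity w c)

/-- The law of the noise-free signal `f C` given the proxy value `w`. -/
def signalLaw (θ : LatentModel n k d 𝒲) (w : 𝒲) : Measure (EuclideanSpace ℝ (Fin d)) :=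
  (θ.latentLaw w).map θ.f

/-- The density `p_θ(x | w) = ∫ p_{H,lam}(c | w) p_ε(x - f c) dc` of the observation `X = f C + ε`
given the proxy value `w`, as an integral of a nonnegative function. -/
def observedDensity (θ : LatentModel n k d 𝒲) (pε : EuclideanSpace ℝ (Fin d) → ℝ) (w : 𝒲)
    (x : EuclideanSpace ℝ (Fin d)) : ENNReal :=
  ∫⁻ c, ENNReal.ofReal (θ.latentDensity w c * pε (x - θ.f c))

/-- The vector `H(c) ∈ ℝ^{nk}` of all sufficient statistics; its `(i, j)` entry is
`H_{i,j}(c_i)`. -/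
def stat (θ : LatentModel n k d 𝒲) (c : Fin n → ℝ) : Fin n × Fin k → ℝ :=
  fun p => θ.H p.1 p.2 (c p.1)

/-- The `nk × nk` matrix with columns `lam (W l) - lam (W 0)`, `l = 1, …, nk`, the row index
`(i, j)` being numbered lexicographically. -/
def diffMatrix (θ : LatentModel n k d 𝒲) (W : Fin (n * k + 1) → 𝒲) :
    Matrix (Fin (n * k)) (Fin (n * k)) ℝ :=
  Matrix.of fun r l =>
    θ.lam (W l.succ) (finProdFinEquiv.symm r).1 (finProdFinEquiv.symm r).2
      - θ.lam (W 0) (finProdFinEquiv.symm r).1 (finProdFinEquiv.symm r).2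

/-- For each `i`, no nontrivial linear combination of `H_{i,1}, …, H_{i,k}` is constant on a set of
positive measure (the family is strongly exponential). -/
def StronglyIndependent (θ : LatentModel n k d 𝒲) : Prop :=
  ∀ i, ∀ A : Set ℝ, MeasurableSet A → 0 < volume A →
    ∀ (a : Fin k → ℝ) (b : ℝ), (∀ t ∈ A, ∑ j, a j * θ.H i j t = b) → a = 0

/-- Both models give the same density of `X` given `W = w`, for every `w` (densities being
compared up to Lebesgue-null sets). -/
def ObservationallyEquivalent (pε : EuclideanSpace ℝ (Fin d) → ℝ)
    (θ θ' : LatentModel n k d 𝒲) : Prop :=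
  ∀ w, θ.observedDensity pε w =ᵐ[volume] θ'.observedDensity pε w

/-- Regular parameters: `f` is a homeomorphism onto its image, the sufficient statistics are
continuous and the base measures have full support. -/
structure Regular (θ : LatentModel n k d 𝒲) : Prop where
  isEmbedding_f : Topology.IsEmbedding θ.f
  continuous_H : ∀ i j, Continuous (θ.H i j)
  Q_pos : ∀ i, ∀ᵐ t : ℝ, 0 < θ.Q i t

end LatentModel

/-- `p` is a probability density on `ℝᵈ`. -/
structure IsProbDensity {d : ℕ} (p : EuclideanSpace ℝ (Fin d) → ℝ) : Prop where
  measurable : Measurable p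
  nonneg : ∀ x, 0 ≤ p x
  lintegral_eq_one : ∫⁻ x, ENNReal.ofReal (p x) = 1

end

/-! The observed law is the signal law convolved with the noise. The noise characteristic function
is nonzero on a dense set, so continuity lets it be cancelled and both models have the same signal
laws (`Measure.eq_of_conv_eq`).

Since `f` is injective, the density of the signal law at `w` relative to `w₀` is the latent
likelihood ratio at `f⁻¹(x)`. The base measures cancel in it, and its logarithm is affine in the
statistics with coefficients `lam w - lam w₀`. Equating the logarithms of both models at `nk` values
of `w` and inverting `L` gives the affine relation (`exists_ae_stat_eq`).

If `v M = 0`, then `v ⬝ᵥ stat` is a.e. constant; the product structure splits this by coordinate,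
and strong independence gives `v = 0`. So `M` is invertible with no condition on `θ'.lam`. For
regular models, density and continuity remove the exceptional set. -/

namespace MeasureTheory

/-! ### Product measures, convolutions and densities -/

/-- If a sum of functions of separate coordinates is a.e. constant for a product measure, then
each summand is a.e. constant. -/
theorem exists_ae_eq_const_of_ae_sum_eq_const {n : ℕ} (ρ : Fin n → Measure ℝ)
    [∀ i, SigmaFinite (ρ i)] (hρ : ∀ i, ρ i ≠ 0) (g : Fin n → ℝ → ℝ) (b : ℝ)
    (h : ∀ᵐ c ∂(Measure.pi ρ), ∑ i, g i (c i) = b) (i : Fin n) :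
    ∃ a : ℝ, ∀ᵐ t ∂(ρ i), g i t = a := by
  cases n with
  | zero => exact i.elim0
  | succ m =>
    have hmp := (measurePreserving_piFinSuccAbove ρ i).symm
    have h' := hmp.quasiMeasurePreserving.ae h
    have h'' := Measure.ae_ae_of_ae_prod (Measure.measurePreserving_swap.quasiMeasurePreserving.ae h')
    have hne : (Measure.pi fun j => ρ (i.succAbove j)) ≠ 0 := by
      rw [ne_eq, ← Measure.measure_univ_eq_zero, Measure.pi_univ, Finset.prod_eq_zero_iff]
      rintro ⟨j, -, hj⟩
      exact hρ _ (Measure.measure_univ_eq_zero.1 hj)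
    have : (ae (Measure.pi fun j => ρ (i.succAbove j))).NeBot := ae_neBot.2 hne
    -- Fubini: freeze the other coordinates at one generic `y`.
    obtain ⟨y, hy⟩ := h''.exists
    refine ⟨b - ∑ j, g (i.succAbove j) (y j), ?_⟩
    filter_upwards [hy] with t ht
    change ∑ l, g l (i.insertNth (α := fun _ => ℝ) t y l) = b at ht
    rw [Fin.sum_univ_succAbove _ i] at ht
    simp only [Fin.insertNth_apply_same, Fin.insertNth_apply_succAbove] at ht
    linarith

/-- Convolution with a finite measure whose characteristic function vanishes only on a
Lebesgue-null set is injective on finite measures. -/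
theorem Measure.eq_of_conv_eq {E : Type*} [NormedAddCommGroup E] [InnerProductSpace ℝ E]
    [FiniteDimensional ℝ E] [MeasurableSpace E] [BorelSpace E] {μ ν κ : Measure E}
    [IsFiniteMeasure μ] [IsFiniteMeasure ν] [IsFiniteMeasure κ]
    (hκ : volume {t | charFun κ t = 0} = 0) (h : μ ∗ κ = ν ∗ κ) : μ = ν := by
  have := FiniteDimensional.complete ℝ E
  apply Measure.ext_of_charFun
  have hd : Dense {t : E | charFun κ t ≠ 0} := dense_of_ae (μ := volume) (by
    rw [ae_iff]; simpa using hκ)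
  refine Continuous.ext_on hd continuous_charFun continuous_charFun fun t ht => ?_
  have := congrArg (fun m => charFun m t) h
  simp only [charFun_conv] at this
  exact mul_right_cancel₀ ht this

/-- The convolution of a measure with one that has a density has a density. -/
theorem Measure.conv_withDensity {G : Type*} [AddCommGroup G] [MeasurableSpace G]
    [MeasurableAdd₂ G] [MeasurableNeg G] {μ π : Measure G} [SFinite μ] [SFinite π]
    [π.IsAddRightInvariant] {p : G → ENNReal} (hp : Measurable p) :
    μ ∗ π.withDensity p = π.withDensity fun x => ∫⁻ y, p (x - y) ∂μ := by
  ext s hs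
  rw [← lintegral_indicator_one hs, Measure.lintegral_conv (measurable_one.indicator hs),
    withDensity_apply _ hs, ← lintegral_indicator hs]
  have h1 : ∀ x, s.indicator (fun x => ∫⁻ y, p (x - y) ∂μ) x
      = ∫⁻ y, s.indicator 1 x * p (x - y) ∂μ := by
    intro x
    by_cases hx : x ∈ s <;> simp [hx]
  simp_rw [h1]
  refine Eq.trans ?_ (lintegral_lintegral_swap
    (f := fun x y => s.indicator 1 x * p (x - y)) ?_).symm
  · refine lintegral_congr fun y => ?_
    refine (lintegral_withDensity_eq_lintegral_mul _ hp
      ((measurable_one.indicator hs).comp (measurable_const_add y))).trans ?_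
    -- Translation invariance: substitute `x - y` for `x`.
    rw [← lintegral_sub_right_eq_self _ y]
    refine lintegral_congr fun x => ?_
    simp [mul_comm]
  · refine Measurable.aemeasurable (Measurable.mul ?_ ?_)
    · exact (measurable_one.indicator hs).comp measurable_fst
    · exact hp.comp (measurable_fst.sub measurable_snd)

/-- Transport of a density along a measurable embedding. -/
theorem _root_.MeasurableEmbedding.map_withDensity_eq {α β : Type*} [MeasurableSpace α]
    [MeasurableSpace β] [Nonempty α] {f : α → β} (hf : MeasurableEmbedding f) (μ : Measure α)
    (r : α → ENNReal) :
    (μ.withDensity r).map f = (μ.map f).withDensity fun x => r (Function.invFun f x) := by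
  ext s hs
  rw [hf.map_apply, withDensity_apply _ (hf.measurable hs), withDensity_apply _ hs,
    hf.restrict_map, hf.lintegral_map]
  simp [Function.leftInverse_invFun hf.injective _]

end MeasureTheory

/-! ### Latent densities and likelihood ratios -/

namespace LatentModel

variable {n k d : ℕ} {𝒲 : Type*}

theorem Z_pos (θ : LatentModel n k d 𝒲) (i : Fin n) (w : 𝒲) : 0 < θ.Z i w :=
  θ.normalizer_pos w i

theorem latentDensity_nonneg (θ : LatentModel n k d 𝒲) (w : 𝒲) (c : Fin n → ℝ) :
    0 ≤ θ.latentDensity w c :=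
  Finset.prod_nonneg fun i _ =>
    mul_nonneg (div_nonneg (θ.Q_nonneg i _) (θ.Z_pos i w).le) (Real.exp_nonneg _)

theorem latentDensity_pos (θ : LatentModel n k d 𝒲) (w : 𝒲) {c : Fin n → ℝ}
    (hc : ∀ i, 0 < θ.Q i (c i)) : 0 < θ.latentDensity w c :=
  Finset.prod_pos fun i _ => mul_pos (div_pos (hc i) (θ.Z_pos i w)) (Real.exp_pos _)

theorem measurable_latentDensity (θ : LatentModel n k d 𝒲) (w : 𝒲) :
    Measurable (θ.latentDensity w) := by
  unfold latentDensity
  have hQ := θ.measurable_Q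
  have hH := θ.measurable_H
  refine Finset.measurable_prod _ fun i _ => Measurable.mul ?_ (Measurable.exp ?_)
  · exact ((hQ i).comp (measurable_pi_apply i)).div_const _
  · exact Finset.measurable_sum _ fun j _ =>
      ((hH i j).comp (measurable_pi_apply i)).mul_const _

theorem integrable_latentDensity (θ : LatentModel n k d 𝒲) (w : 𝒲) :
    Integrable (θ.latentDensity w) := by
  refine Integrable.fintype_prod (μ := fun _ : Fin n => (volume : Measure ℝ))
    (f := fun i t => θ.Q i t / θ.Z i w * Real.exp (∑ j, θ.H i j t * θ.lam w i j)) fun i => ?_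
  refine ((θ.integrable_weight w i).div_const (θ.Z i w)).congr (ae_of_all _ fun t => ?_)
  simp only
  ring

instance (θ : LatentModel n k d 𝒲) (w : 𝒲) : IsFiniteMeasure (θ.latentLaw w) :=
  isFiniteMeasure_withDensity_ofReal (θ.integrable_latentDensity w).2

instance (θ : LatentModel n k d 𝒲) (w : 𝒲) : IsFiniteMeasure (θ.signalLaw w) :=
  inferInstanceAs (IsFiniteMeasure ((θ.latentLaw w).map θ.f))

/-- The likelihood ratio `p(c | w) / p(c | w₀)`. -/
noncomputable def likelihoodRatio (θ : LatentModel n k d 𝒲) (w₀ w : 𝒲) (c : Fin n → ℝ) : ℝ :=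
  (∏ i, θ.Z i w₀ / θ.Z i w) * Real.exp (∑ i, ∑ j, θ.H i j (c i) * (θ.lam w i j - θ.lam w₀ i j))

theorem likelihoodRatio_pos (θ : LatentModel n k d 𝒲) (w₀ w : 𝒲) (c : Fin n → ℝ) :
    0 < θ.likelihoodRatio w₀ w c :=
  mul_pos (Finset.prod_pos fun i _ => div_pos (θ.Z_pos i w₀) (θ.Z_pos i w)) (Real.exp_pos _)

theorem log_likelihoodRatio (θ : LatentModel n k d 𝒲) (w₀ w : 𝒲) (c : Fin n → ℝ) :
    Real.log (θ.likelihoodRatio w₀ w c) = Real.log (∏ i, θ.Z i w₀ / θ.Z i w) +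
      ∑ i, ∑ j, θ.H i j (c i) * (θ.lam w i j - θ.lam w₀ i j) := by
  rw [likelihoodRatio, Real.log_mul _ (Real.exp_pos _).ne', Real.log_exp]
  exact (Finset.prod_pos fun i _ => div_pos (θ.Z_pos i w₀) (θ.Z_pos i w)).ne'

theorem measurable_likelihoodRatio (θ : LatentModel n k d 𝒲) (w₀ w : 𝒲) :
    Measurable (θ.likelihoodRatio w₀ w) := by
  refine Measurable.const_mul (Measurable.exp ?_) _
  exact Finset.measurable_sum _ fun i _ => Finset.measurable_sum _ fun j _ =>
    ((θ.measurable_H i j).comp (measurable_pi_apply i)).mul_const _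

/-- The base measures do not depend on `w`, so the ratio is free of `Q` and strictly positive; the
identity holds even where the densities vanish. -/
theorem latentDensity_eq_mul (θ : LatentModel n k d 𝒲) (w₀ w : 𝒲) (c : Fin n → ℝ) :
    θ.latentDensity w c = θ.latentDensity w₀ c * θ.likelihoodRatio w₀ w c := by
  rw [likelihoodRatio, Real.exp_sum, ← Finset.prod_mul_distrib, latentDensity, latentDensity,
    ← Finset.prod_mul_distrib]
  refine Finset.prod_congr rfl fun i _ => ?_
  have h0 := (θ.Z_pos i w₀).ne'
  have h1 := (θ.Z_pos i w).ne'
  have : Real.exp (∑ j, θ.H i j (c i) * θ.lam w i j)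
      = Real.exp (∑ j, θ.H i j (c i) * θ.lam w₀ i j)
        * Real.exp (∑ j, θ.H i j (c i) * (θ.lam w i j - θ.lam w₀ i j)) := by
    rw [← Real.exp_add, ← Finset.sum_add_distrib]
    congr 1
    exact Finset.sum_congr rfl fun j _ => by ring
  rw [this]
  field_simp

theorem latentLaw_eq_withDensity (θ : LatentModel n k d 𝒲) (w₀ w : 𝒲) :
    θ.latentLaw w =
      (θ.latentLaw w₀).withDensity fun c => ENNReal.ofReal (θ.likelihoodRatio w₀ w c) := by
  rw [latentLaw, latentLaw, ← withDensity_mul _ (θ.measurable_latentDensity w₀).ennreal_ofReal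
    (θ.measurable_likelihoodRatio w₀ w).ennreal_ofReal]
  congr 1 with c
  rw [Pi.mul_apply, ← ENNReal.ofReal_mul (θ.latentDensity_nonneg w₀ c), ← latentDensity_eq_mul]

/-- Lusin–Souslin: an injective Borel map between standard Borel spaces has Borel images, so
densities transport along `f` without continuity. -/
theorem measurableEmbedding_f (θ : LatentModel n k d 𝒲) (hf : Function.Injective θ.f) :
    MeasurableEmbedding θ.f :=
  θ.measurable_f.measurableEmbedding hf

theorem signalLaw_eq_withDensity (θ : LatentModel n k d 𝒲) (hf : Function.Injective θ.f)
    (w₀ w : 𝒲) :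
    θ.signalLaw w = (θ.signalLaw w₀).withDensity fun x =>
      ENNReal.ofReal (θ.likelihoodRatio w₀ w (Function.invFun θ.f x)) := by
  rw [signalLaw, θ.latentLaw_eq_withDensity w₀ w,
    (θ.measurableEmbedding_f hf).map_withDensity_eq, signalLaw]

theorem aemeasurable_likelihoodRatio_invFun (θ : LatentModel n k d 𝒲)
    (hf : Function.Injective θ.f) (w₀ w : 𝒲) :
    AEMeasurable (fun x => θ.likelihoodRatio w₀ w (Function.invFun θ.f x)) (θ.signalLaw w₀) := by
  rw [signalLaw, (θ.measurableEmbedding_f hf).aemeasurable_map_iff]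
  refine (θ.measurable_likelihoodRatio w₀ w).aemeasurable.congr (ae_of_all _ fun c => ?_)
  simp [Function.leftInverse_invFun hf c]

theorem ae_mem_range_f (θ : LatentModel n k d 𝒲) (hf : Function.Injective θ.f) (w : 𝒲) :
    ∀ᵐ x ∂(θ.signalLaw w), x ∈ range θ.f :=
  (θ.measurableEmbedding_f hf).ae_map_iff.2 (ae_of_all _ fun c => mem_range_self c)

/-! ### Deconvolution and comparison of likelihood ratios -/

theorem withDensity_observedDensity (θ : LatentModel n k d 𝒲)
    {pε : EuclideanSpace ℝ (Fin d) → ℝ} (hpε : Measurable pε) (w : 𝒲) :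
    volume.withDensity (θ.observedDensity pε w) =
      θ.signalLaw w ∗ volume.withDensity fun x => ENNReal.ofReal (pε x) := by
  rw [Measure.conv_withDensity hpε.ennreal_ofReal]
  congr 1 with x
  have hm : Measurable fun y => ENNReal.ofReal (pε (x - y)) :=
    (hpε.comp (measurable_const.sub measurable_id)).ennreal_ofReal
  rw [signalLaw, lintegral_map hm θ.measurable_f]
  refine Eq.trans ?_ (lintegral_withDensity_eq_lintegral_mul volume
    (θ.measurable_latentDensity w).ennreal_ofReal (hm.comp θ.measurable_f)).symm
  refine lintegral_congr fun c => ?_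
  rw [ENNReal.ofReal_mul (θ.latentDensity_nonneg w c)]
  rfl

/-- Deconvolution: observationally equivalent models have the same signal laws. -/
theorem ObservationallyEquivalent.signalLaw_eq {pε : EuclideanSpace ℝ (Fin d) → ℝ}
    (hpε : IsProbDensity pε)
    (hchar : volume {t : EuclideanSpace ℝ (Fin d) |
      charFun (volume.withDensity fun x => ENNReal.ofReal (pε x)) t = 0} = 0)
    {θ θ' : LatentModel n k d 𝒲} (hobs : ObservationallyEquivalent pε θ θ') (w : 𝒲) :
    θ.signalLaw w = θ'.signalLaw w := by
  have : IsFiniteMeasure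
      ((volume : Measure (EuclideanSpace ℝ (Fin d))).withDensity fun x => ENNReal.ofReal (pε x)) :=
    isFiniteMeasure_withDensity (by simp [hpε.lintegral_eq_one])
  refine Measure.eq_of_conv_eq hchar ?_
  rw [← withDensity_observedDensity θ hpε.measurable,
    ← withDensity_observedDensity θ' hpε.measurable]
  exact withDensity_congr_ae (hobs w)

/-- The likelihood ratios of two models with the same signal laws agree along the signal. -/
theorem ae_likelihoodRatio_eq {θ θ' : LatentModel n k d 𝒲} (hf : Function.Injective θ.f)
    (hf' : Function.Injective θ'.f) (h : ∀ w, θ.signalLaw w = θ'.signalLaw w) (w₀ w : 𝒲) :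
    ∀ᵐ x ∂(θ.signalLaw w₀), θ.likelihoodRatio w₀ w (Function.invFun θ.f x) =
      θ'.likelihoodRatio w₀ w (Function.invFun θ'.f x) := by
  have hm := θ.aemeasurable_likelihoodRatio_invFun hf w₀ w
  have hm' := θ'.aemeasurable_likelihoodRatio_invFun hf' w₀ w
  rw [← h w₀] at hm'
  -- Both ratios are densities of one law relative to the common signal law at `w₀`, hence a.e.
  -- equal.
  have key := h w
  rw [θ.signalLaw_eq_withDensity hf w₀ w, θ'.signalLaw_eq_withDensity hf' w₀ w, ← h w₀,
    withDensity_eq_iff_of_sigmaFinite hm.ennreal_ofReal hm'.ennreal_ofReal] at key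
  filter_upwards [key] with x hx
  exact (ENNReal.ofReal_eq_ofReal_iff (θ.likelihoodRatio_pos _ _ _).le
    (θ'.likelihoodRatio_pos _ _ _).le).1 hx

/-! ### Strong independence under the latent law -/

/-- Under strong independence no nontrivial linear combination of all sufficient statistics is
a.e. constant under the latent law. -/
theorem StronglyIndependent.eq_zero_of_ae_dotProduct_stat_eq {θ : LatentModel n k d 𝒲}
    (hind : θ.StronglyIndependent) {w : 𝒲} {v : Fin n × Fin k → ℝ} {b : ℝ}
    (h : ∀ᵐ c ∂(θ.latentLaw w), v ⬝ᵥ θ.stat c = b) : v = 0 := by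
  have hS : ∀ i, MeasurableSet {t | 0 < θ.Q i t} := fun i =>
    measurableSet_lt measurable_const (θ.measurable_Q i)
  have hSpos : ∀ i, volume {t | 0 < θ.Q i t} ≠ 0 := by
    intro i h0
    refine (θ.normalizer_pos w i).ne' (integral_eq_zero_of_ae ?_)
    have : ∀ᵐ t, ¬ 0 < θ.Q i t := by rw [ae_iff]; simpa using h0
    filter_upwards [this] with t ht
    simp [le_antisymm (not_lt.1 ht) (θ.Q_nonneg i t)]
  -- The latent density is positive on the box `∏ {Q i > 0}`, so the identity passes to Lebesgue
  -- measure on that box, a product measure.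
  have hpi : ∀ᵐ c ∂(Measure.pi fun i => volume.restrict {t | 0 < θ.Q i t}),
      ∑ i, ∑ j, v (i, j) * θ.H i j (c i) = b := by
    rw [← Measure.restrict_pi_pi, ae_restrict_iff' (MeasurableSet.univ_pi hS), ← volume_pi]
    rw [latentLaw, ae_withDensity_iff (θ.measurable_latentDensity w).ennreal_ofReal] at h
    filter_upwards [h] with c hc hcS
    rw [← hc (ENNReal.ofReal_pos.2 (θ.latentDensity_pos w fun i => hcS i (mem_univ i))).ne',
      dotProduct, Fintype.sum_prod_type]
    rfl
  have hne : ∀ i, volume.restrict {t | 0 < θ.Q i t} ≠ 0 := fun i =>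
    fun h0 => hSpos i (Measure.restrict_eq_zero.1 h0)
  ext ⟨i, j⟩
  obtain ⟨a, ha⟩ := exists_ae_eq_const_of_ae_sum_eq_const _ hne
    (fun i t => ∑ j, v (i, j) * θ.H i j t) b hpi i
  have hA : MeasurableSet ({t | 0 < θ.Q i t} ∩ {t | ∑ j, v (i, j) * θ.H i j t = a}) :=
    (hS i).inter (measurableSet_eq_fun
      (Finset.measurable_sum _ fun j _ => (θ.measurable_H i j).const_mul _) measurable_const)
  refine congrFun (hind i _ hA ?_ (fun j => v (i, j)) a fun t ht => ht.2) j
  rw [ae_restrict_iff' (hS i)] at ha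
  rw [pos_iff_ne_zero]
  refine fun h0 => hSpos i ?_
  rw [← h0]
  refine measure_congr ?_
  filter_upwards [ha] with t ht
  exact propext ⟨fun h => ⟨h, ht h⟩, fun h => h.1⟩

/-! ### Extension by continuity for regular models -/

theorem continuous_stat {θ : LatentModel n k d 𝒲} (hH : ∀ i j, Continuous (θ.H i j)) :
    Continuous θ.stat :=
  continuous_pi fun p => (hH p.1 p.2).comp (continuous_apply p.1)

theorem Regular.continuousOn_stat_invFun {θ : LatentModel n k d 𝒲} (h : θ.Regular) :
    ContinuousOn (fun x => θ.stat (Function.invFun θ.f x)) (range θ.f) := by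
  refine (continuous_stat h.continuous_H).comp_continuousOn ?_
  -- As `f` is an embedding, continuity of `f⁻¹` on the image can be tested after composing with
  -- `f`, which gives the inclusion.
  rw [continuousOn_iff_continuous_domRestrict, h.isEmbedding_f.continuous_iff]
  convert continuous_subtype_val (p := fun x => x ∈ range θ.f) using 1
  exact funext fun x => Function.invFun_eq x.2

theorem Regular.isOpenPosMeasure_latentLaw {θ : LatentModel n k d 𝒲} (h : θ.Regular) (w : 𝒲) :
    (θ.latentLaw w).IsOpenPosMeasure := by
  refine (withDensity_absolutelyContinuous'
    (θ.measurable_latentDensity w).ennreal_ofReal.aemeasurable ?_).isOpenPosMeasure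
  have : ∀ᵐ c : Fin n → ℝ, ∀ i, 0 < θ.Q i (c i) :=
    ae_all_iff.2 fun i =>
      (Measure.quasiMeasurePreserving_eval (fun _ : Fin n => (volume : Measure ℝ)) i).ae (h.Q_pos i)
  filter_upwards [this] with c hc
  exact (ENNReal.ofReal_pos.2 (θ.latentDensity_pos w hc)).ne'

/-- For regular models, an identity between the statistics that holds almost everywhere under the
signal law holds on the intersection of the images. -/
theorem Regular.stat_eq_of_ae {θ θ' : LatentModel n k d 𝒲} (h : θ.Regular) (h' : θ'.Regular)
    {w : 𝒲} {M : Matrix (Fin n × Fin k) (Fin n × Fin k) ℝ} {q : Fin n × Fin k → ℝ}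
    (hae : ∀ᵐ x ∂(θ.signalLaw w), x ∈ range θ.f ∧ x ∈ range θ'.f ∧
      θ.stat (Function.invFun θ.f x) = M.mulVec (θ'.stat (Function.invFun θ'.f x)) + q)
    {x : EuclideanSpace ℝ (Fin d)} (hx : x ∈ range θ.f ∩ range θ'.f) :
    θ.stat (Function.invFun θ.f x) = M.mulVec (θ'.stat (Function.invFun θ'.f x)) + q := by
  set S := {x | x ∈ range θ.f ∧ x ∈ range θ'.f ∧
    θ.stat (Function.invFun θ.f x) = M.mulVec (θ'.stat (Function.invFun θ'.f x)) + q}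
  have hSD : S ⊆ range θ.f ∩ range θ'.f := fun y hy => ⟨hy.1, hy.2.1⟩
  -- A latent-a.e. set is dense in `ℝⁿ`, and continuity of `f` carries this density to its image.
  have hcl : x ∈ closure S := by
    obtain ⟨c, rfl⟩ := hx.1
    have := h.isOpenPosMeasure_latentLaw w
    have hd : Dense {c | θ.f c ∈ S} :=
      Measure.dense_of_ae (ae_of_ae_map θ.measurable_f.aemeasurable hae)
    exact map_mem_closure h.isEmbedding_f.continuous (hd c) fun _ hc => hc
  have : (nhdsWithin x S).NeBot := mem_closure_iff_nhdsWithin_neBot.1 hcl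
  have hl := (h.continuousOn_stat_invFun x hx.1).mono_left
    (nhdsWithin_mono x (hSD.trans inter_subset_left))
  have hr := (h'.continuousOn_stat_invFun x hx.2).mono_left
    (nhdsWithin_mono x (hSD.trans inter_subset_right))
  have hr' := (((Continuous.matrix_mulVec (continuous_const (y := M)) continuous_id).add
    (continuous_const (y := q))).tendsto _).comp hr
  refine tendsto_nhds_unique_of_eventuallyEq hl hr' ?_
  filter_upwards [self_mem_nhdsWithin] with y hy
  exact hy.2.2

/-! ### The affine relation -/

/-- The matrix `diffMatrix`, with rows and columns indexed by pairs. -/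
def pairDiffMatrix (θ : LatentModel n k d 𝒲) (W : Fin (n * k + 1) → 𝒲) :
    Matrix (Fin n × Fin k) (Fin n × Fin k) ℝ :=
  (θ.diffMatrix W).submatrix finProdFinEquiv finProdFinEquiv

/-- The logarithms of the ratios of the normalization constants. -/
noncomputable def logNormalizerRatio (θ : LatentModel n k d 𝒲) (W : Fin (n * k + 1) → 𝒲) :
    Fin n × Fin k → ℝ :=
  fun r => Real.log (∏ i, θ.Z i (W 0) / θ.Z i (W (finProdFinEquiv r).succ))

theorem log_likelihoodRatio_eq_mulVec (θ : LatentModel n k d 𝒲) (W : Fin (n * k + 1) → 𝒲)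
    (c : Fin n → ℝ) :
    (fun r => Real.log (θ.likelihoodRatio (W 0) (W (finProdFinEquiv r).succ) c)) =
      θ.logNormalizerRatio W + (θ.pairDiffMatrix W).transpose.mulVec (θ.stat c) := by
  ext r
  rw [log_likelihoodRatio, Pi.add_apply, logNormalizerRatio, Matrix.mulVec, dotProduct,
    Fintype.sum_prod_type]
  simp only [Matrix.transpose_apply, pairDiffMatrix, diffMatrix, Matrix.submatrix_apply,
    Matrix.of_apply, Equiv.symm_apply_apply, stat, mul_comm]

/-- Models with the same signal laws have affinely related sufficient statistics. -/
theorem exists_ae_stat_eq {θ θ' : LatentModel n k d 𝒲} (hf : Function.Injective θ.f)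
    (hf' : Function.Injective θ'.f) (h : ∀ w, θ.signalLaw w = θ'.signalLaw w)
    {W : Fin (n * k + 1) → 𝒲} (hW : IsUnit (θ.diffMatrix W)) :
    ∃ (M : Matrix (Fin n × Fin k) (Fin n × Fin k) ℝ) (q : Fin n × Fin k → ℝ),
      ∀ᵐ x ∂(θ.signalLaw (W 0)), x ∈ range θ.f ∧ x ∈ range θ'.f ∧
        θ.stat (Function.invFun θ.f x) = M.mulVec (θ'.stat (Function.invFun θ'.f x)) + q := by
  set A := (θ.pairDiffMatrix W).transpose with hA
  have hdet : IsUnit A.det := by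
    rw [hA, Matrix.det_transpose, ← Matrix.isUnit_iff_isUnit_det]
    exact (Matrix.isUnit_submatrix_equiv _ _).2 hW
  -- Solve `r + A s = r' + A' s'` for `s`, where `s`, `s'` are the statistics and `r`, `r'` the log
  -- normalizer ratios.
  refine ⟨A⁻¹ * (θ'.pairDiffMatrix W).transpose,
    A⁻¹.mulVec (θ'.logNormalizerRatio W - θ.logNormalizerRatio W), ?_⟩
  have hae : ∀ᵐ x ∂(θ.signalLaw (W 0)), ∀ r : Fin n × Fin k, _ :=
    ae_all_iff.2 fun r => ae_likelihoodRatio_eq hf hf' h (W 0) (W (finProdFinEquiv r).succ)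
  have hrange' := θ'.ae_mem_range_f hf' (W 0)
  rw [← h] at hrange'
  filter_upwards [hae, θ.ae_mem_range_f hf (W 0), hrange'] with x hx h1 h2
  refine ⟨h1, h2, ?_⟩
  have hlog : (fun r => Real.log (θ.likelihoodRatio (W 0) (W (finProdFinEquiv r).succ)
      (Function.invFun θ.f x))) = fun r => Real.log (θ'.likelihoodRatio (W 0)
        (W (finProdFinEquiv r).succ) (Function.invFun θ'.f x)) :=
    funext fun r => congrArg Real.log (hx r)
  rw [log_likelihoodRatio_eq_mulVec, log_likelihoodRatio_eq_mulVec] at hlog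
  rw [← Matrix.mulVec_mulVec, ← Matrix.mulVec_add,
    show (θ'.pairDiffMatrix W).transpose.mulVec (θ'.stat (Function.invFun θ'.f x)) +
      (θ'.logNormalizerRatio W - θ.logNormalizerRatio W) =
        A.mulVec (θ.stat (Function.invFun θ.f x)) by
      rw [add_sub, add_comm, ← hlog, add_sub_cancel_left],
    Matrix.mulVec_mulVec, Matrix.nonsing_inv_mul _ hdet, Matrix.one_mulVec]

end LatentModel


theorem theorem2 {n k d : ℕ} {𝒲 : Type*}
    (pε : EuclideanSpace ℝ (Fin d) → ℝ) (hpε : IsProbDensity pε)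
    (θ : LatentModel n k d 𝒲)
    -- the zero set of the characteristic function of the noise is Lebesgue-null
    (hchar : volume {t : EuclideanSpace ℝ (Fin d) |
      charFun (volume.withDensity fun x => ENNReal.ofReal (pε x)) t = 0} = 0)
    -- the mixing function is injective
    (hf : Function.Injective θ.f)
    -- the sufficient statistics are differentiable a.e. and strongly independent
    (hdiff : ∀ i j, ∀ᵐ t : ℝ, DifferentiableAt ℝ (θ.H i j) t)
    (hind : θ.StronglyIndependent)
    -- there are `nk + 1` distinct proxy values with invertible difference matrix
    (hL : ∃ W : Fin (n * k + 1) → 𝒲, Function.Injective W ∧ IsUnit (θ.diffMatrix W))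
    -- any other parameters, with injective mixing function, giving the same observed densities
    (θ' : LatentModel n k d 𝒲) (hf' : Function.Injective θ'.f)
    (hobs : LatentModel.ObservationallyEquivalent pε θ θ') :
    ∃ (M : Matrix (Fin n × Fin k) (Fin n × Fin k) ℝ) (q : Fin n × Fin k → ℝ), IsUnit M ∧
      (∀ w, ∀ᵐ x ∂(θ.signalLaw w), x ∈ range θ.f ∧ x ∈ range θ'.f ∧
        θ.stat (Function.invFun θ.f x) = M.mulVec (θ'.stat (Function.invFun θ'.f x)) + q) ∧
      (θ.Regular → θ'.Regular → ∀ x ∈ range θ.f ∩ range θ'.f,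
        θ.stat (Function.invFun θ.f x) = M.mulVec (θ'.stat (Function.invFun θ'.f x)) + q) := by
  obtain ⟨W, -, hW⟩ := hL
  have hlaw := hobs.signalLaw_eq hpε hchar
  obtain ⟨M, q, hMq⟩ := LatentModel.exists_ae_stat_eq hf hf' hlaw hW
  have hall : ∀ w, ∀ᵐ x ∂(θ.signalLaw w), x ∈ range θ.f ∧ x ∈ range θ'.f ∧
      θ.stat (Function.invFun θ.f x) = M.mulVec (θ'.stat (Function.invFun θ'.f x)) + q := by
    intro w
    -- Every signal law is absolutely continuous with respect to the one at `W 0`.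
    rw [θ.signalLaw_eq_withDensity hf (W 0) w]
    exact (withDensity_absolutelyContinuous _ _).ae_le hMq
  refine ⟨M, q, ?_, hall, fun h h' x hx => h.stat_eq_of_ae h' (hall (W 0)) hx⟩
  rw [Matrix.isUnit_iff_isUnit_det, isUnit_iff_ne_zero]
  intro hdet
  -- A left null vector of `M` would make `v ⬝ᵥ stat` a.e. equal to the constant `v ⬝ᵥ q`.
  obtain ⟨v, hv, hvM⟩ := Matrix.exists_vecMul_eq_zero_iff.2 hdet
  refine hv (hind.eq_zero_of_ae_dotProduct_stat_eq (w := W 0) (b := v ⬝ᵥ q) ?_)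
  filter_upwards [ae_of_ae_map θ.measurable_f.aemeasurable hMq] with c hc
  have hc' := hc.2.2
  rw [Function.leftInverse_invFun hf c] at hc'
  rw [hc', dotProduct_add, Matrix.dotProduct_mulVec, hvM, zero_dotProduct, zero_add]
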